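/- Let $G\curvearrowright X$ be a continuous action of a countable group on a compact metrizable space. The action is said to have the small boundary property (SBP) if the topology of $X$ has a basis of open sets $U$ such that $\mu(\partial U)=0$ for every $G$-invariant Borel probability measure $\mu$ on $X$. For a further action $H\curvearrowright Y$, the product action $G\times H\curvearrowright X\times Y$ is given by $(g,h)(x,y)=(gx,hy)$. Then the following are equivalent: (1) the action $G\curvearrowright X$ has the SBP and no finite orbits; (2) for every continuous action $H\curvearrowright Y$ of a countable group on a compact metrizable space, the product action $G\times H\curvearrowright X\times Y$ has the SBP. In particular, condition (2) holds whenever $X$ is infinite and the action $G\curvearrowright X$ is minimal (every orbit is dense) and has the SBP (in this case $G$ is necessarily infinite). -/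

import Mathlib

open MeasureTheory TopologicalSpace

universe u v w z

/-- A set `A` is `N`-small, for a set `N` of Borel probability measures, if the supremum of `μ A`
over `μ ∈ N` is zero (the supremum over the empty family is `0`). -/
def IsSmallFor {X : Type*} [MeasurableSpace X] (N : Set (ProbabilityMeasure X)) (A : Set X) :
    Prop :=
  ⨆ μ ∈ N, (μ : Measure X) A = 0

/-- The `N`-small boundary property: the topology has a basis of (open) sets whose boundaries are
`N`-small. -/
def HasSmallBoundaryPropertyFor (X : Type*) [TopologicalSpace X] [MeasurableSpace X]
    (N : Set (ProbabilityMeasure X)) : Prop :=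
  ∃ B : Set (Set X), IsTopologicalBasis B ∧ ∀ U ∈ B, IsSmallFor N (frontier U)

/-- The set of `G`-invariant probability measures on `X`. -/
def invariantProbabilityMeasures (G X : Type*) [Group G] [MulAction G X] [MeasurableSpace X] :
    Set (ProbabilityMeasure X) :=
  {μ | SMulInvariantMeasure G X (μ : Measure X)}

/-- The small boundary property (SBP) of an action of `G` on a topological space `X`, with respect
to all `G`-invariant probability measures on the Borel `σ`-algebra of `X`. -/
def HasSBP (G X : Type*) [Group G] [TopologicalSpace X] [MulAction G X] : Prop :=
  letI : MeasurableSpace X := borel X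
  HasSmallBoundaryPropertyFor X (invariantProbabilityMeasures G X)

/-- The product action `G × H ↷ X × Y`, `(g, h) • (x, y) = (g • x, h • y)`. -/
instance productAction (G H X Y : Type*) [Group G] [Group H] [MulAction G X] [MulAction H Y] :
    MulAction (G × H) (X × Y) where
  smul g p := (g.1 • p.1, g.2 • p.2)
  one_smul p := Prod.ext (one_smul G p.1) (one_smul H p.2)
  mul_smul g g' p := Prod.ext (mul_smul g.1 g'.1 p.1) (mul_smul g.2 g'.2 p.2)

/-! The core is a continuous `θ` on `X`, with `|θ| < 1/4`, whose thickened fibres are uniformly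
small for all invariant measures (`HasThinFibers`). It exists by Baire: thinness up to `ε` is open,
and by the SBP and the absence of atoms (orbits are infinite) it is dense. Given a Urysohn function
`f` on `Y`, the sets `{f + θ < 1/2}`, cut by small-boundary sets of `X`, then form small
neighbourhoods in `X × Y`. Their boundaries are null because slicing an invariant measure over a
subset of `Y` gives, up to scaling, an invariant measure on `X`. Conversely, a one-point `Y`
recovers the SBP, and a connected `Y` with trivial action rules out finite orbits. -/

/-! ### Compactness and atoms of invariant measures -/

open Filter Topology in
theorem IsCompact.exists_isOpen_measure_lt {X : Type*} [TopologicalSpace X] [CompactSpace X]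
    [MetrizableSpace X] [MeasurableSpace X] [BorelSpace X] {N : Set (ProbabilityMeasure X)}
    (hN : IsCompact N) {C : Set X} (hC : IsClosed C) (h0 : ∀ μ ∈ N, (μ : Measure X) C = 0)
    {ε : ENNReal} (hε : ε ≠ 0) :
    ∃ U, IsOpen U ∧ C ⊆ U ∧ ∀ μ ∈ N, (μ : Measure X) U < ε := by
  let := metrizableSpaceMetric X
  refine hN.induction_on (p := fun s => ∃ U, IsOpen U ∧ C ⊆ U ∧ ∀ μ ∈ s, (μ : Measure X) U < ε)
    ⟨Set.univ, isOpen_univ, Set.subset_univ _, by simp⟩ ?_ ?_ ?_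
  · rintro s t hst ⟨U, hU, hCU, h⟩
    exact ⟨U, hU, hCU, fun μ hμ => h μ (hst hμ)⟩
  · rintro s t ⟨U, hU, hCU, h⟩ ⟨V, hV, hCV, h'⟩
    refine ⟨U ∩ V, hU.inter hV, Set.subset_inter hCU hCV, ?_⟩
    rintro μ (hμ | hμ)
    · exact (measure_mono Set.inter_subset_left).trans_lt (h μ hμ)
    · exact (measure_mono Set.inter_subset_right).trans_lt (h' μ hμ)
  · intro μ hμ
    have hlim := tendsto_measure_cthickening_of_isClosed (μ := (μ : Measure X)) (s := C)
      ⟨1, one_pos, MeasureTheory.measure_ne_top _ _⟩ hC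
    rw [h0 μ hμ] at hlim
    obtain ⟨r, hr, hr0⟩ := (((hlim.eventually_lt_const (pos_iff_ne_zero.mpr hε)).filter_mono
      (nhdsWithin_le_nhds (s := Set.Ioi 0))).and self_mem_nhdsWithin).exists
    -- Portmanteau: the measure of a closed set is upper semicontinuous, so the bound at `μ`
    -- persists nearby.
    have hsup := ProbabilityMeasure.limsup_measure_closed_le_of_tendsto
      (tendsto_id (x := 𝓝 μ)) (Metric.isClosed_cthickening (δ := r) (E := C))
    refine ⟨_, nhdsWithin_le_nhds (eventually_lt_of_limsup_lt (hsup.trans_lt hr)),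
      Metric.thickening r C, Metric.isOpen_thickening, Metric.self_subset_thickening hr0 C, ?_⟩
    intro ν hν
    exact (measure_mono (Metric.thickening_subset_cthickening r C)).trans_lt hν

theorem isCompact_invariantProbabilityMeasures (G X : Type*) [Group G] [TopologicalSpace X]
    [CompactSpace X] [MetrizableSpace X] [MeasurableSpace X] [BorelSpace X]
    [MulAction G X] [ContinuousConstSMul G X] :
    IsCompact (invariantProbabilityMeasures G X) := by
  have heq : invariantProbabilityMeasures G X = ⋂ g : G, {μ : ProbabilityMeasure X |
      ProbabilityMeasure.map μ
        (continuous_const_smul (T := X) g).measurable.aemeasurable = μ} := by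
    ext μ
    simp only [invariantProbabilityMeasures, Set.mem_ofPred_eq, Set.mem_iInter]
    constructor
    · intro h g
      refine ProbabilityMeasure.toMeasure_injective (Measure.ext fun s hs => ?_)
      rw [ProbabilityMeasure.toMeasure_map,
        Measure.map_apply (continuous_const_smul g).measurable hs]
      exact h.measure_preimage_smul g hs
    · intro h
      refine ⟨fun g s hs => ?_⟩
      conv_rhs => rw [← h g]
      rw [ProbabilityMeasure.toMeasure_map,
        Measure.map_apply (continuous_const_smul g).measurable hs]
  rw [heq]
  exact (isClosed_iInter fun g => isClosed_eq
    (ProbabilityMeasure.continuous_map (continuous_const_smul g)) continuous_id).isCompact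

theorem measure_singleton_eq_zero_of_infinite_orbit {G X : Type*} [Group G] [MulAction G X]
    [MeasurableSpace X] [MeasurableSingletonClass X] (μ : Measure X) [IsFiniteMeasure μ]
    [SMulInvariantMeasure G X μ] {x : X} (hx : (MulAction.orbit G x).Infinite) : μ {x} = 0 := by
  by_contra h
  refine measure_ne_top μ _ (hx.meas_eq_top ⟨μ {x}, h, ?_⟩)
  rintro _ ⟨g, rfl⟩
  have := SMulInvariantMeasure.measure_preimage_smul (μ := μ) g
    (measurableSet_singleton (g • x))
  rw [← this]
  exact measure_mono (by simp)

theorem isSmallFor_iff {X : Type*} [MeasurableSpace X] {N : Set (ProbabilityMeasure X)}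
    {A : Set X} : IsSmallFor N A ↔ ∀ μ ∈ N, (μ : Measure X) A = 0 := by
  simp [IsSmallFor]

/-- Frees the definition from its fixed `borel X`, so that the product σ-algebra serves on `X × Y`.
-/
theorem hasSBP_iff {G X : Type*} [Group G] [TopologicalSpace X] [MulAction G X]
    [m : MeasurableSpace X] [hm : BorelSpace X] :
    HasSBP G X ↔ ∀ (x : X) (O : Set X), IsOpen O → x ∈ O → ∃ U, IsOpen U ∧ x ∈ U ∧ U ⊆ O ∧
      ∀ μ ∈ invariantProbabilityMeasures G X, (μ : Measure X) (frontier U) = 0 := by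
  obtain rfl := hm.measurable_eq
  let _ : MeasurableSpace X := borel X
  unfold HasSBP HasSmallBoundaryPropertyFor
  simp only [isSmallFor_iff]
  constructor
  · rintro ⟨B, hB, h⟩ x O hO hx
    obtain ⟨U, hU, hxU, hUO⟩ := hB.exists_subset_of_mem_open hx hO
    exact ⟨U, hB.isOpen hU, hxU, hUO, h U hU⟩
  · intro h
    refine ⟨{U | IsOpen U ∧ ∀ μ ∈ invariantProbabilityMeasures G X,
      (μ : Measure X) (frontier U) = 0}, ?_, fun U hU => hU.2⟩
    refine isTopologicalBasis_of_isOpen_of_nhds (fun U hU => hU.1) fun x O hx hO => ?_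
    obtain ⟨U, hU, hxU, hUO, h'⟩ := h x O hO hx
    exact ⟨U, ⟨hU, h'⟩, hxU, hUO⟩

/-! ### Functions with thin fibres -/

theorem exists_fin_cover_of_forall_exists_isOpen {X : Type*} [TopologicalSpace X]
    [CompactSpace X] {P : Set X → Prop} (h : ∀ x, ∃ U, IsOpen U ∧ x ∈ U ∧ P U) :
    ∃ (n : ℕ) (U : Fin n → Set X), (∀ i, IsOpen (U i) ∧ P (U i)) ∧ ∀ x, ∃ i, x ∈ U i := by
  choose U hU hxU hP using h
  obtain ⟨t, ht⟩ := isCompact_univ.elim_finite_subcover U hU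
    fun x _ => Set.mem_iUnion.2 ⟨x, hxU x⟩
  refine ⟨t.card, fun i => U (t.equivFin.symm i), fun i => ⟨hU _, hP _⟩, fun x => ?_⟩
  obtain ⟨y, hy, hxy⟩ := Set.mem_iUnion₂.1 (ht (Set.mem_univ x))
  exact ⟨t.equivFin ⟨y, hy⟩, by simpa using hxy⟩

open Filter Topology in
theorem exists_separated_perturbation {n : ℕ} (a : Fin n → ℝ) {η : ℝ} (hη : 0 < η) :
    ∃ t : Fin n → ℝ, (∀ i, |t i - a i| < η) ∧
      ∃ δ > 0, ∀ i j, i ≠ j → 2 * δ < |t i - t j| := by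
  have h1 : ∀ᶠ s : ℝ in 𝓝[>] 0, ∀ i : Fin n, |s * (i : ℝ)| < η := by
    refine eventually_all.2 fun i => nhdsWithin_le_nhds ?_
    have : Tendsto (fun s : ℝ => |s * (i : ℝ)|) (𝓝 0) (𝓝 |0 * (i : ℝ)|) :=
      Continuous.tendsto (by fun_prop) 0
    exact this.eventually_lt_const (by simpa using hη)
  have h2 : ∀ᶠ s : ℝ in 𝓝[>] 0, ∀ i j : Fin n, i ≠ j → a i + s * i ≠ a j + s * j := by
    refine eventually_all.2 fun i => eventually_all.2 fun j => ?_
    by_cases hij : i = j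
    · simp [hij]
    have hij' : (i : ℝ) - j ≠ 0 := by
      rw [sub_ne_zero]
      exact_mod_cast fun h => hij (Fin.ext h)
    -- Each pair collides for only one value of `s`.
    have h3 : ∀ᶠ s : ℝ in 𝓝[>] 0, s ≠ (a j - a i) / (i - j) := by
      by_cases hc : (a j - a i) / ((i : ℝ) - j) = 0
      · rw [hc]
        filter_upwards [self_mem_nhdsWithin] with s hs using ne_of_gt hs
      · exact nhdsWithin_le_nhds (isOpen_ne.mem_nhds (Ne.symm hc))
    filter_upwards [h3] with s hs _ heq
    apply hs
    rw [eq_div_iff hij']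
    linarith
  obtain ⟨s, hs1, hs2⟩ := (h1.and h2).exists
  refine ⟨fun i => a i + s * i, fun i => by simpa using hs1 i, ?_⟩
  have h4 : ∀ᶠ δ : ℝ in 𝓝[>] 0, ∀ i j : Fin n, i ≠ j →
      2 * δ < |(a i + s * i) - (a j + s * j)| := by
    refine eventually_all.2 fun i => eventually_all.2 fun j => ?_
    by_cases hij : i = j
    · simp [hij]
    have : Tendsto (fun δ : ℝ => 2 * δ) (𝓝 0) (𝓝 (2 * 0)) := Continuous.tendsto (by fun_prop) 0
    rw [mul_zero] at this
    filter_upwards [nhdsWithin_le_nhds (this.eventually_lt_const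
      (abs_pos.2 (sub_ne_zero.2 (hs2 i j hij))))] with δ hδ _ using hδ
  obtain ⟨δ, hδ, hδ0⟩ := (h4.and self_mem_nhdsWithin).exists
  exact ⟨δ, hδ0, hδ⟩

/-- The fibres of `θ`, slightly thickened, have measure at most `ε` for all `μ ∈ N`. -/
def HasThinFibers {X : Type*} [MeasurableSpace X] (N : Set (ProbabilityMeasure X))
    (ε : ENNReal) (θ : X → ℝ) : Prop :=
  ∃ δ > 0, ∀ μ ∈ N, ∀ t : ℝ, (μ : Measure X) {x | |θ x - t| ≤ δ} ≤ ε

theorem isOpen_setOf_hasThinFibers {X : Type*} [TopologicalSpace X] [CompactSpace X]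
    [MeasurableSpace X] (N : Set (ProbabilityMeasure X)) (ε : ENNReal) :
    IsOpen {θ : C(X, ℝ) | HasThinFibers N ε θ} := by
  rw [Metric.isOpen_iff]
  rintro θ ⟨δ, hδ, h⟩
  refine ⟨δ / 2, half_pos hδ, fun θ' hθ' => ⟨δ / 2, half_pos hδ, fun μ hμ t => ?_⟩⟩
  refine (measure_mono fun x hx => ?_).trans (h μ hμ t)
  have hd : |θ' x - θ x| ≤ δ / 2 := by
    rw [← Real.dist_eq]
    exact (ContinuousMap.dist_apply_le_dist x).trans (le_of_lt hθ')
  have hx' : |θ' x - t| ≤ δ / 2 := hx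
  change |θ x - t| ≤ δ
  rw [abs_le] at *
  constructor <;> linarith

-- Off an open set `O` of small measure containing the boundaries of a cover by small sets, `θ` can
-- be moved to a locally constant function with separated values. Each thickened fibre then lies in
-- `O` together with at most one set of the cover.
open Filter Topology in
theorem dense_setOf_hasThinFibers {X : Type*} [TopologicalSpace X] [CompactSpace X]
    [MetrizableSpace X] [MeasurableSpace X] [BorelSpace X] {N : Set (ProbabilityMeasure X)}
    (hN : IsCompact N) (hpt : ∀ μ ∈ N, ∀ x, (μ : Measure X) {x} = 0)
    (hsbp : ∀ (x : X) (O : Set X), IsOpen O → x ∈ O → ∃ U, IsOpen U ∧ x ∈ U ∧ U ⊆ O ∧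
      ∀ μ ∈ N, (μ : Measure X) (frontier U) = 0) {ε : ENNReal} (hε : ε ≠ 0) :
    Dense {θ : C(X, ℝ) | HasThinFibers N ε θ} := by
  rw [Metric.dense_iff]
  intro θ r hr
  have hε2 : ε / 2 ≠ 0 := (ENNReal.half_pos hε).ne'
  obtain ⟨n, U, hU, hcov⟩ := exists_fin_cover_of_forall_exists_isOpen
    (P := fun U => (∃ a : ℝ, ∀ x ∈ U, |θ x - a| < r / 4) ∧
      (∀ μ ∈ N, (μ : Measure X) U ≤ ε / 2) ∧ ∀ μ ∈ N, (μ : Measure X) (frontier U) = 0) (by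
      intro x
      obtain ⟨V, hV, hxV, hVε⟩ := hN.exists_isOpen_measure_lt (isClosed_singleton (x := x))
        (fun μ hμ => hpt μ hμ x) hε2
      obtain ⟨W, hW, hxW, hWV, hW0⟩ := hsbp x (V ∩ {y | |θ y - θ x| < r / 4})
        (hV.inter (isOpen_lt (by fun_prop) continuous_const))
        ⟨hxV rfl, by simpa using hr⟩
      exact ⟨W, hW, hxW, ⟨θ x, fun y hy => (hWV hy).2⟩, fun μ hμ =>
        (measure_mono (hWV.trans Set.inter_subset_left)).trans (hVε μ hμ).le, hW0⟩)
  choose a ha using fun i => (hU i).2.1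
  obtain ⟨t, hta, δ, hδ, hsep⟩ := exists_separated_perturbation a (η := r / 4) (by positivity)
  obtain ⟨O, hO, hDO, hOε⟩ := hN.exists_isOpen_measure_lt (C := ⋃ i, frontier (U i))
    (isClosed_iUnion_of_finite fun i => isClosed_frontier)
    (fun μ hμ => measure_iUnion_null fun i => (hU i).2.2.2 μ hμ) hε2
  -- The first cover element containing `x`; this index can jump only on the boundaries, hence only
  -- inside `O`.
  have hmin : ∀ x, ∃ i, x ∈ U i ∧ ∀ j < i, x ∉ U j := fun x => by
    obtain ⟨i, hi, hi'⟩ := wellFounded_lt.has_min {i | x ∈ U i} (hcov x)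
    exact ⟨i, hi, fun j hj hjx => hi' j hjx hj⟩
  choose idx hidx hidx' using hmin
  have hloc : ∀ x ∈ Oᶜ, ∀ᶠ y in 𝓝 x, idx y = idx x := by
    intro x hx
    have h1 : ∀ᶠ y in 𝓝 x, ∀ j, j < idx x → y ∉ U j := by
      refine eventually_all.2 fun j => ?_
      by_cases hj : j < idx x
      · have hxc : x ∉ closure (U j) := fun hc => hx (hDO (Set.mem_iUnion.2
          ⟨j, hc, fun hi => hidx' x j hj (interior_subset hi)⟩))
        filter_upwards [isClosed_closure.isOpen_compl.mem_nhds hxc] with y hy _ hyU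
          using hy (subset_closure hyU)
      · simp [hj]
    filter_upwards [h1, (hU (idx x)).1.mem_nhds (hidx x)] with y hy hy'
    rcases lt_trichotomy (idx y) (idx x) with h | h | h
    · exact absurd (hidx y) (hy _ h)
    · exact h
    · exact absurd hy' (hidx' y _ h)
  have hcont : ContinuousOn (fun x => t (idx x) - θ x) Oᶜ := by
    intro x hx
    refine ContinuousAt.continuousWithinAt (ContinuousAt.sub ?_ θ.continuous.continuousAt)
    refine (continuousAt_const (y := t (idx x))).congr ?_
    filter_upwards [hloc x hx] with y hy
    rw [hy]
  have hK : IsClosed Oᶜ := hO.isClosed_compl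
  have : CompactSpace (Oᶜ : Set X) := isCompact_iff_compactSpace.1 hK.isCompact
  -- Tietze is applied to the correction, not to the new function, so the bound `r / 2` holds on all
  -- of `X`.
  obtain ⟨d, hd, hdr⟩ := BoundedContinuousFunction.exists_forall_mem_domRestrict_eq_of_closed
    (BoundedContinuousFunction.mkOfCompact ⟨_, hcont.domRestrict⟩) hK
    (t := Set.Icc (-(r / 2)) (r / 2)) (by
      rintro ⟨x, hx⟩
      have h1 := ha _ x (hidx x)
      have h2 := hta (idx x)
      change -(r / 2) ≤ t (idx x) - θ x ∧ t (idx x) - θ x ≤ r / 2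
      rw [abs_lt] at h1 h2
      constructor <;> linarith) ⟨0, by constructor <;> linarith⟩
  have hdx : ∀ x ∈ Oᶜ, d x = t (idx x) - θ x := fun x hx => DFunLike.congr_fun hdr ⟨x, hx⟩
  refine ⟨θ + d.toContinuousMap, ?_, δ, hδ, fun μ hμ s => ?_⟩
  · rw [Metric.mem_ball, dist_comm, ContinuousMap.dist_lt_iff hr]
    intro x
    rw [Real.dist_eq]
    have := hd x
    change |θ x - (θ x + d x)| < r
    rw [abs_lt]
    constructor <;> linarith [this.1, this.2]
  · by_cases hex : ∃ i, |t i - s| ≤ δ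
    · obtain ⟨i, hi⟩ := hex
      calc (μ : Measure X) {x | |(θ + d.toContinuousMap) x - s| ≤ δ}
          ≤ (μ : Measure X) (O ∪ U i) := by
            refine measure_mono fun x hx => ?_
            by_cases hxO : x ∈ O
            · exact Or.inl hxO
            right
            have hx' : |θ x + d x - s| ≤ δ := hx
            rw [hdx x hxO, add_sub_cancel] at hx'
            have : idx x = i := by
              by_contra hne
              have h1 := hsep _ _ hne
              have h2 := abs_sub_le (t (idx x)) s (t i)
              rw [abs_sub_comm s] at h2
              linarith
            exact this ▸ hidx x
        _ ≤ ε / 2 + ε / 2 :=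
            (measure_union_le _ _).trans (add_le_add (hOε μ hμ).le ((hU i).2.2.1 μ hμ))
        _ = ε := ENNReal.add_halves ε
    · refine (measure_mono fun x hx => ?_).trans ((hOε μ hμ).le.trans ENNReal.half_le_self)
      by_contra hxO
      have hx' : |θ x + d x - s| ≤ δ := hx
      rw [hdx x hxO, add_sub_cancel] at hx'
      exact hex ⟨_, hx'⟩

theorem exists_continuousMap_hasThinFibers {X : Type*} [TopologicalSpace X] [CompactSpace X]
    [MetrizableSpace X] [MeasurableSpace X] [BorelSpace X] {N : Set (ProbabilityMeasure X)}
    (hN : IsCompact N) (hpt : ∀ μ ∈ N, ∀ x, (μ : Measure X) {x} = 0)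
    (hsbp : ∀ (x : X) (O : Set X), IsOpen O → x ∈ O → ∃ U, IsOpen U ∧ x ∈ U ∧ U ⊆ O ∧
      ∀ μ ∈ N, (μ : Measure X) (frontier U) = 0) :
    ∃ θ : C(X, ℝ), (∀ x, |θ x| < 1 / 4) ∧ ∀ ε ≠ 0, HasThinFibers N ε θ := by
  -- For `n = 0` the bound is `⊤` and imposes nothing.
  have hd : Dense (⋂ n : ℕ, {θ : C(X, ℝ) | HasThinFibers N (n : ENNReal)⁻¹ θ}) :=
    dense_iInter_of_isOpen_nat (fun n => isOpen_setOf_hasThinFibers N _)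
      fun n => dense_setOf_hasThinFibers hN hpt hsbp (by simp)
  obtain ⟨θ, hθ, hθN⟩ := Metric.dense_iff.1 hd 0 (1 / 4) (by norm_num)
  refine ⟨θ, fun x => ?_, fun ε hε => ?_⟩
  · have := (ContinuousMap.dist_apply_le_dist x).trans_lt (Metric.mem_ball.1 hθ)
    simpa using this
  · obtain ⟨n, hn⟩ := ENNReal.exists_inv_nat_lt hε
    obtain ⟨δ, hδ, h⟩ := Set.mem_iInter.1 hθN n
    exact ⟨δ, hδ, fun μ hμ t => (h μ hμ t).trans hn.le⟩

/-! ### Invariant measures on products and the forward implication -/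

/-- Slicing an invariant measure on a product over a measurable set of the second factor gives a
multiple of an invariant probability measure on the first factor. -/
theorem measure_prod_le_of_forall_invariant {G H X Y : Type*} [Group G] [Group H]
    [MulAction G X] [MulAction H Y] [MeasurableSpace X] [MeasurableSpace Y]
    [MeasurableConstSMul G X] (μ : Measure (X × Y)) [IsFiniteMeasure μ]
    [SMulInvariantMeasure (G × H) (X × Y) μ] {E : Set X} (hE : MeasurableSet E)
    {V : Set Y} (hV : MeasurableSet V) {ε : ENNReal}
    (h : ∀ ν ∈ invariantProbabilityMeasures G X, (ν : Measure X) E ≤ ε) :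
    μ (E ×ˢ V) ≤ ε * μ (Set.univ ×ˢ V) := by
  have hUV : MeasurableSet ((Set.univ : Set X) ×ˢ V) := MeasurableSet.univ.prod hV
  by_cases h0 : μ (Set.univ ×ˢ V) = 0
  · rw [h0, mul_zero, nonpos_iff_eq_zero]
    exact measure_mono_null (Set.prod_mono_left (Set.subset_univ E)) h0
  set lam : Measure X := (ProbabilityTheory.cond μ (Set.univ ×ˢ V)).map Prod.fst with hlam
  have hval : ∀ A, MeasurableSet A → lam A = (μ (Set.univ ×ˢ V))⁻¹ * μ (A ×ˢ V) := by
    intro A hA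
    rw [hlam, Measure.map_apply measurable_fst hA, ProbabilityTheory.cond_apply hUV]
    congr 2
    ext ⟨x, y⟩
    simp [and_comm]
  have := ProbabilityTheory.cond_isProbabilityMeasure h0
  have : IsProbabilityMeasure lam := Measure.isProbabilityMeasure_map measurable_fst.aemeasurable
  have hinv : (⟨lam, inferInstance⟩ : ProbabilityMeasure X) ∈
      invariantProbabilityMeasures G X := by
    refine ⟨fun g s hs => ?_⟩
    change lam _ = lam _
    rw [hval _ hs, hval _ (measurable_const_smul g hs)]
    congr 1
    -- Elements `(g, 1)` preserve the strip over `V`, so no invariance of `V` is needed.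
    rw [← SMulInvariantMeasure.measure_preimage_smul (μ := μ) ((g, 1) : G × H) (hs.prod hV)]
    congr 1
    ext ⟨x, y⟩
    change _ ↔ (g • x ∈ s ∧ (1 : H) • y ∈ V)
    simp
  have := h _ hinv
  change lam E ≤ ε at this
  rw [hval E hE, mul_comm, ← div_eq_mul_inv,
    ENNReal.div_le_iff h0 (measure_ne_top _ _)] at this
  exact this

/-- Over a piece of `Y` where `f` varies by less than `δ`, the level set confines `θ` to one
thickened fibre, so it takes at most a fraction `ε` of the strip; the strips sum to total mass 1. -/
theorem measure_setOf_add_eq_zero_of_hasThinFibers {G H X Y : Type*} [Group G] [Group H]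
    [MulAction G X] [MulAction H Y] [MeasurableSpace X] [MeasurableSpace Y]
    [MeasurableConstSMul G X] (μ : Measure (X × Y)) [IsProbabilityMeasure μ]
    [SMulInvariantMeasure (G × H) (X × Y) μ] {θ : X → ℝ} (hθm : Measurable θ)
    (hθ : ∀ ε ≠ 0, HasThinFibers (invariantProbabilityMeasures G X) ε θ)
    {f : Y → ℝ} (hf : Measurable f) (c : ℝ) : μ {p | f p.2 + θ p.1 = c} = 0 := by
  by_contra hne
  obtain ⟨ε, hε0, hε⟩ := exists_between (pos_iff_ne_zero.2 hne)
  refine absurd hε (not_lt.2 ?_)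
  obtain ⟨δ, hδ, h⟩ := hθ ε hε0.ne'
  set V : ℤ → Set Y := fun k => {y | ⌊f y / δ⌋ = k} with hVdef
  have hV : ∀ k, MeasurableSet (V k) := fun k =>
    (Int.measurable_floor.comp (hf.div_const δ)) (measurableSet_singleton k)
  have hE : ∀ s : ℝ, MeasurableSet {x | |θ x - s| ≤ δ} := fun s =>
    measurableSet_le (by fun_prop) measurable_const
  calc μ {p | f p.2 + θ p.1 = c}
      ≤ μ (⋃ k : ℤ, {x | |θ x - (c - k * δ)| ≤ δ} ×ˢ V k) := by
        refine measure_mono fun p hp => Set.mem_iUnion.2 ⟨⌊f p.2 / δ⌋, ?_, rfl⟩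
        have hp' : f p.2 + θ p.1 = c := hp
        have h1 := Int.floor_le (f p.2 / δ)
        have h2 := Int.lt_floor_add_one (f p.2 / δ)
        rw [le_div_iff₀ hδ] at h1
        rw [div_lt_iff₀ hδ] at h2
        change |_| ≤ δ
        rw [abs_le]
        constructor <;> linarith
    _ ≤ ∑' k : ℤ, μ ({x | |θ x - (c - k * δ)| ≤ δ} ×ˢ V k) := measure_iUnion_le _
    _ ≤ ∑' k : ℤ, ε * μ (Set.univ ×ˢ V k) := ENNReal.tsum_le_tsum fun k =>
        measure_prod_le_of_forall_invariant (G := G) (H := H) μ (hE _) (hV k)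
          fun ν hν => h ν hν _
    _ = ε * μ (⋃ k, Set.univ ×ˢ V k) := by
        rw [ENNReal.tsum_mul_left, measure_iUnion _ fun k => MeasurableSet.univ.prod (hV k)]
        intro i j hij
        refine Set.disjoint_left.2 fun p hp hp' => hij ?_
        exact hp.2.symm.trans hp'.2
    _ ≤ ε := (mul_le_mul_right prob_le_one ε).trans_eq (mul_one ε)

theorem HasSBP.prod {G H X Y : Type*} [Group G] [TopologicalSpace X] [CompactSpace X]
    [MetrizableSpace X] [MulAction G X] [ContinuousConstSMul G X] [Group H]
    [TopologicalSpace Y] [CompactSpace Y] [MetrizableSpace Y] [MulAction H Y]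
    (hX : HasSBP G X) (horb : ∀ x : X, (MulAction.orbit G x).Infinite) :
    HasSBP (G × H) (X × Y) := by
  let : MeasurableSpace X := borel X
  have : BorelSpace X := ⟨rfl⟩
  let : MeasurableSpace Y := borel Y
  have : BorelSpace Y := ⟨rfl⟩
  let := metrizableSpaceMetric X
  let := metrizableSpaceMetric Y
  have hX' := hasSBP_iff.1 hX
  obtain ⟨θ, hθ, hthin⟩ := exists_continuousMap_hasThinFibers
    (isCompact_invariantProbabilityMeasures G X) (fun μ hμ x => by
      have : SMulInvariantMeasure G X (μ : Measure X) := hμ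
      exact measure_singleton_eq_zero_of_infinite_orbit (μ : Measure X) (horb x)) hX'
  rw [hasSBP_iff]
  rintro ⟨x, y⟩ O hO hxy
  obtain ⟨A, V, hA, hV, hxA, hyV, hAV⟩ := isOpen_prod_iff.1 hO x y hxy
  obtain ⟨U, hU, hxU, hUA, hU0⟩ := hX' x A hA hxA
  obtain ⟨f, hf0, hf1, -⟩ := exists_continuous_zero_one_of_isClosed
    (isClosed_singleton (x := y)) hV.isClosed_compl (by simpa using hyV)
  have hlt : IsOpen {p : X × Y | f p.2 + θ p.1 < 1 / 2} :=
    isOpen_lt (by fun_prop) continuous_const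
  -- Since `|θ| < 1/4`, the sum `f + θ` is below `1/4` at `(x, y)` and above `3/4` outside `V`, so
  -- the level `1/2` separates them.
  refine ⟨Prod.fst ⁻¹' U ∩ {p | f p.2 + θ p.1 < 1 / 2}, (hU.preimage continuous_fst).inter hlt,
    ⟨hxU, ?_⟩, ?_, ?_⟩
  · have h1 := hf0 (Set.mem_singleton y)
    have h2 := (abs_lt.1 (hθ x)).2
    simp only [Pi.zero_apply] at h1
    change f y + θ x < 1 / 2
    linarith
  · rintro ⟨a, b⟩ ⟨ha, hb⟩
    refine hAV ⟨hUA ha, ?_⟩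
    by_contra hbV
    have h1 := hf1 hbV
    have h2 := (abs_lt.1 (hθ a)).1
    simp only [Pi.one_apply] at h1
    change f b + θ a < 1 / 2 at hb
    linarith
  · intro μ hμ
    have : SMulInvariantMeasure (G × H) (X × Y) (μ : Measure (X × Y)) := hμ
    refine measure_mono_null (t := (frontier U ×ˢ Set.univ) ∪ {p | f p.2 + θ p.1 = 1 / 2}) ?_
      (measure_union_null ?_ ?_)
    · refine (frontier_inter_subset _ _).trans (Set.union_subset_union ?_ ?_)
      · refine Set.inter_subset_left.trans ?_
        refine (continuous_fst.frontier_preimage_subset U).trans fun p hp => ⟨hp, trivial⟩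
      · exact Set.inter_subset_right.trans
          (frontier_lt_subset_eq (by fun_prop) continuous_const)
    · have := measure_prod_le_of_forall_invariant (G := G) (H := H) (μ : Measure (X × Y))
        isClosed_frontier.measurableSet (MeasurableSet.univ (α := Y)) (ε := 0)
        (fun ν hν => (hU0 ν hν).le)
      simpa using this
    · exact measure_setOf_add_eq_zero_of_hasThinFibers (G := G) (H := H) _
        θ.continuous.measurable hthin f.continuous.measurable _

/-! ### The converse and the main theorem -/

theorem HasSBP.of_prod_unique {G H X Y : Type*} [Group G] [TopologicalSpace X]
    [CompactSpace X] [MetrizableSpace X] [MulAction G X] [ContinuousConstSMul G X] [Group H]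
    [TopologicalSpace Y] [CompactSpace Y] [MetrizableSpace Y] [Unique Y] [MulAction H Y]
    (h : HasSBP (G × H) (X × Y)) : HasSBP G X := by
  let : MeasurableSpace X := borel X
  have : BorelSpace X := ⟨rfl⟩
  let : MeasurableSpace Y := borel Y
  have : BorelSpace Y := ⟨rfl⟩
  let := metrizableSpaceMetric X
  let := metrizableSpaceMetric Y
  rw [hasSBP_iff] at h ⊢
  intro x O hO hx
  obtain ⟨U, hU, hxU, hUO, hU0⟩ := h (x, default) (Prod.fst ⁻¹' O) (hO.preimage continuous_fst) hx
  have hi : Continuous fun x : X => (x, (default : Y)) := by fun_prop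
  refine ⟨_, hU.preimage hi, hxU, fun z hz => hUO hz, fun μ hμ => ?_⟩
  refine measure_mono_null (hi.frontier_preimage_subset U) ?_
  have : SMulInvariantMeasure G X (μ : Measure X) := hμ
  have := hU0 (ProbabilityMeasure.map μ hi.measurable.aemeasurable) ⟨fun g s hs => by
    have hg : Continuous fun p : X × Y => g • p :=
      ((continuous_const_smul g.1).comp continuous_fst).prodMk
        (continuous_of_const fun _ _ => Subsingleton.elim _ _)
    rw [ProbabilityMeasure.toMeasure_map, Measure.map_apply hi.measurable (hg.measurable hs),
      Measure.map_apply hi.measurable hs,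
      ← SMulInvariantMeasure.measure_preimage_smul (μ := (μ : Measure X)) g.1
        (hi.measurable hs)]
    congr 1
    ext z
    change (g.1 • z, g.2 • (default : Y)) ∈ s ↔ (g.1 • z, default) ∈ s
    rw [Subsingleton.elim (g.2 • (default : Y)) default]⟩
  rwa [ProbabilityMeasure.toMeasure_map,
    Measure.map_apply hi.measurable isClosed_frontier.measurableSet] at this

/-- If the orbit of `x` is finite and `Y` is a nontrivial connected space on which `H` acts
trivially, then the uniform measure on the orbit times a point mass is invariant, so the fibre
over `x` meets no small boundary. -/
theorem HasSBP.orbit_infinite_of_prod {G H X Y : Type*} [Group G] [TopologicalSpace X]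
    [CompactSpace X] [MetrizableSpace X] [MulAction G X] [ContinuousConstSMul G X] [Group H]
    [TopologicalSpace Y] [CompactSpace Y] [MetrizableSpace Y] [ConnectedSpace Y] [Nontrivial Y]
    [MulAction H Y] (htriv : ∀ (k : H) (y : Y), k • y = y)
    (h : HasSBP (G × H) (X × Y)) (x : X) : (MulAction.orbit G x).Infinite := by
  intro hfin
  let : MeasurableSpace X := borel X
  have : BorelSpace X := ⟨rfl⟩
  let : MeasurableSpace Y := borel Y
  have : BorelSpace Y := ⟨rfl⟩
  let := metrizableSpaceMetric X
  let := metrizableSpaceMetric Y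
  rw [hasSBP_iff] at h
  obtain ⟨y, z, hyz⟩ := exists_pair_ne Y
  obtain ⟨U, hU, hxU, hUO, hU0⟩ := h (x, y) (Prod.snd ⁻¹' {z}ᶜ)
    (isOpen_compl_singleton.preimage continuous_snd) hyz
  have : Finite (MulAction.orbit G x) := hfin
  have : Fintype (MulAction.orbit G x) := Fintype.ofFinite _
  have : Nonempty (MulAction.orbit G x) := ⟨⟨x, MulAction.mem_orbit_self x⟩⟩
  have hfront : ∀ w : Y, (x, w) ∉ frontier U := by
    intro w hw
    -- Counting measure on the orbit at height `w`, normalized below; a boundary point `(x, w)`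
    -- would carry positive mass.
    let ν : Measure (X × Y) := ∑ o : MulAction.orbit G x, Measure.dirac ((o : X), w)
    have hν : ∀ s, MeasurableSet s → ν s =
        ∑ o : MulAction.orbit G x, s.indicator 1 ((o : X), w) := fun s hs => by
      simp only [ν, Measure.finsetSum_apply, Measure.dirac_apply' _ hs]
    have hν1 : ν Set.univ = Fintype.card (MulAction.orbit G x) := by
      rw [hν _ MeasurableSet.univ]
      simp
    have hc0 : (Fintype.card (MulAction.orbit G x) : ENNReal) ≠ 0 := by
      exact_mod_cast Fintype.card_ne_zero
    have : IsProbabilityMeasure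
        ((Fintype.card (MulAction.orbit G x) : ENNReal)⁻¹ • ν) := ⟨by
      rw [Measure.smul_apply, hν1, smul_eq_mul]
      exact ENNReal.inv_mul_cancel hc0 (ENNReal.natCast_ne_top _)⟩
    have key := hU0 ⟨(Fintype.card (MulAction.orbit G x) : ENNReal)⁻¹ • ν, inferInstance⟩
      ⟨fun g s hs => by
        have hg : Continuous fun p : X × Y => g • p := by
          refine ((continuous_const_smul g.1).comp continuous_fst).prodMk ?_
          simpa only [htriv] using continuous_snd
        rw [ProbabilityMeasure.coe_mk, Measure.smul_apply, Measure.smul_apply]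
        congr 1
        rw [hν _ hs, hν _ (hg.measurable hs)]
        refine Fintype.sum_equiv (MulAction.toPerm g.1) _ _ fun o => ?_
        change s.indicator 1 (g.1 • (o : X), g.2 • w) = s.indicator 1 (g.1 • (o : X), w)
        rw [htriv]⟩
    rw [ProbabilityMeasure.coe_mk, Measure.smul_apply, smul_eq_mul, mul_eq_zero, hν _ isClosed_frontier.measurableSet] at key
    rcases key with key | key
    · exact ENNReal.natCast_ne_top _ (ENNReal.inv_eq_zero.1 key)
    · rw [Finset.sum_eq_zero_iff] at key
      have := key ⟨x, MulAction.mem_orbit_self x⟩ (Finset.mem_univ _)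
      simp [hw] at this
  have hi : Continuous fun w : Y => (x, w) := by fun_prop
  -- The slice of `U` over `x` has empty boundary and contains `y`, so connectedness makes it all of
  -- `Y`, although `U` avoids height `z`.
  have hclopen : IsClopen ((fun w : Y => (x, w)) ⁻¹' U) := by
    rw [isClopen_iff_frontier_eq_empty, Set.eq_empty_iff_forall_notMem]
    exact fun w hw => hfront w (hi.frontier_preimage_subset U hw)
  have huniv := hclopen.eq_univ ⟨y, hxU⟩
  have hz : z ∈ (fun w : Y => (x, w)) ⁻¹' U := huniv ▸ Set.mem_univ z
  exact hUO hz rfl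

theorem MulAction.IsMinimal.orbit_infinite {G X : Type*} [Group G] [TopologicalSpace X]
    [T1Space X] [MulAction G X] [Infinite X] (h : MulAction.IsMinimal G X) (x : X) :
    (MulAction.orbit G x).Infinite := by
  intro hfin
  have h1 := (h.dense_orbit x).closure_eq
  rw [hfin.isClosed.closure_eq] at h1
  exact Set.infinite_univ (h1 ▸ hfin)

theorem theoremA {G : Type u} {X : Type v} [Group G] [Countable G]
    [TopologicalSpace X] [CompactSpace X] [MetrizableSpace X]
    [MulAction G X] [ContinuousConstSMul G X] :
    ((HasSBP G X ∧ ∀ x : X, (MulAction.orbit G x).Infinite) ↔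
      ∀ (H : Type w) (Y : Type z) [Group H] [Countable H]
        [TopologicalSpace Y] [CompactSpace Y] [MetrizableSpace Y]
        [MulAction H Y] [ContinuousConstSMul H Y],
        HasSBP (G × H) (X × Y)) ∧
    (Infinite X → MulAction.IsMinimal G X → HasSBP G X →
      ∀ (H : Type w) (Y : Type z) [Group H] [Countable H]
        [TopologicalSpace Y] [CompactSpace Y] [MetrizableSpace Y]
        [MulAction H Y] [ContinuousConstSMul H Y],
        HasSBP (G × H) (X × Y)) := by
  refine ⟨⟨fun h H Y _ _ _ _ _ _ _ => h.1.prod h.2, fun h => ⟨?_, ?_⟩⟩,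
    fun _ hmin hX H Y _ _ _ _ _ _ _ => hX.prod hmin.orbit_infinite⟩
  · exact (h PUnit PUnit).of_prod_unique
  -- The test space is the unit interval with trivial action, lifted to the required universe.
  · let : MulAction PUnit.{w + 1} (ULift.{z} unitInterval) :=
      { smul := fun _ y => y
        one_smul := fun _ => rfl
        mul_smul := fun _ _ _ => rfl }
    have : ContinuousConstSMul PUnit.{w + 1} (ULift.{z} unitInterval) :=
      ⟨fun _ => continuous_id⟩
    have : ConnectedSpace (ULift.{z} unitInterval) :=
      Homeomorph.ulift.symm.surjective.connectedSpace Homeomorph.ulift.symm.continuous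
    have : MetrizableSpace (ULift.{z} unitInterval) :=
      Homeomorph.ulift.isEmbedding.metrizableSpace
    exact (h PUnit (ULift unitInterval)).orbit_infinite_of_prod fun _ _ => rfl
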